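/- Let $d\ge 2$, $N\ge 1$, and let $A_1(0),\dots,A_d(0)$ be real $N\times N$ matrices (the coefficients of the system $\partial_t u+\sum_{i=1}^d A_i(u)\,\partial_i u=0$ frozen at $u=0$), with $A_d(0)$ invertible. For $(\tau,\eta,\xi)\in\mathbb R\times\mathbb R^{d-1}\times\mathbb R$ put $$L(0,(\tau,\eta,\xi))=\tau I+\sum_{i=1}^{d-1}\eta_iA_i(0)+\xi A_d(0),$$ and call $(\tau,\eta,\xi)$ characteristic if $\det L(0,(\tau,\eta,\xi))=0$. Assume strict hyperbolicity: there are real functions $\tau_1<\dots<\tau_N$, analytic on $\mathbb R^d\setminus\{0\}$, such that $\det L(0,(\tau,\eta,\xi))=\prod_{k=1}^N(\tau-\tau_k(\eta,\xi))$ for all $(\eta,\xi)\in\mathbb R^d\setminus\{0\}$ and $\tau\in\mathbb R$. Assume also that, for all $k$ and all $(\eta,\xi)\ne 0$, $\partial_\xi\tau_k(\eta,\xi)=0$ implies $\partial_\xi^2\tau_k(\eta,\xi)\neq 0$. Let the glancing set $\mathcal G$ be the set of all $\zeta=(\tau,\eta)\in\mathbb R^d\setminus\{0\}$ for which there are a real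 number $\xi$ and an index $k$ such that $(\tau,\eta,\xi)$ is characteristic, $\tau=\tau_k(\eta,\xi)$ and $\partial_\xi\tau_k(\eta,\xi)=0$; assume that $\mathcal G$ is not empty. For a characteristic frequency $\alpha=(\tau,\eta,\xi)\neq 0$ with $\tau=\tau_k(\eta,\xi)$, let $\tilde\pi_\alpha$ be the projector of $\mathbb C^N$ onto the $k$-th summand of the decomposition $$\mathbb C^N=\bigoplus_{j=1}^N A_d(0)^{-1}\ker L\big(0,(\tau_j(\eta,\xi),\eta,\xi)\big)$$ along the other summands. Then there is a constant $C>0$ such that, for every characteristic frequency $\alpha=(\tau,\eta,\xi)\in\mathbb R^{1+d}\setminus\{0\}$, every $k$ with $\tau=\tau_k(\eta,\xi)$, and every unit vector $E_k(\eta,\xi)$ of the line $\ker L(0,\alpha)\subset\mathbb C^N$, $$|\partial_\xi\tau_k(\eta,\xi)|\ \ge\ C\,\frac{\operatorname{dist}\big((\tau,\eta),\mathcal G\big)^{1/2}}{|(\tau,\eta)|^{1/2}} \qquad\text{and}\qquad \big|\tilde\pi_\alpha E_k(\eta,\xi)\big|\ \ge\ C\,\frac{\operatorname{dist}\big((\tau,\eta),\mathcal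 G\big)^{1/2}}{|(\tau,\eta)|^{1/2}},$$ where $|\cdot|$ and $\operatorname{dist}$ are the Euclidean (Hermitian) norm and distance. -/

import Mathlib

noncomputable section

namespace HypBVP

/-- Frequencies `ζ = (τ, η) ∈ ℝ × ℝ^{d-1} = ℝ^d` on the boundary, with the Euclidean norm;
throughout `d = n + 1`. -/
abbrev BdryFreq (n : ℕ) := WithLp 2 (ℝ × EuclideanSpace ℝ (Fin n))

/-- Spatial frequencies `(η, ξ) ∈ ℝ^{d-1} × ℝ`. -/
abbrev SpaceFreq (n : ℕ) := EuclideanSpace ℝ (Fin n) × ℝ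

variable {n N : ℕ}

/-- The matrix `A(η, ξ) = ∑_{i=1}^{d-1} η_i A_i(0) + ξ A_d(0)`. The family `A` lists the matrices
`A_1(0), …, A_d(0)`, so that `A (Fin.last n)` is `A_d(0)`. -/
def spatialSymbol (A : Fin (n + 1) → Matrix (Fin N) (Fin N) ℝ)
    (η : EuclideanSpace ℝ (Fin n)) (ξ : ℝ) : Matrix (Fin N) (Fin N) ℝ :=
  ∑ i : Fin n, η i • A i.castSucc + ξ • A (Fin.last n)

/-- The symbol `L(0, (τ, η, ξ)) = τ I + A(η, ξ)`. -/
def symbol (A : Fin (n + 1) → Matrix (Fin N) (Fin N) ℝ)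
    (t : ℝ) (η : EuclideanSpace ℝ (Fin n)) (ξ : ℝ) : Matrix (Fin N) (Fin N) ℝ :=
  t • (1 : Matrix (Fin N) (Fin N) ℝ) + spatialSymbol A η ξ

/-- `(τ, η, ξ)` is a characteristic frequency: `p(τ, η, ξ) = det L(0, (τ, η, ξ)) = 0`. -/
def IsCharacteristic (A : Fin (n + 1) → Matrix (Fin N) (Fin N) ℝ)
    (t : ℝ) (η : EuclideanSpace ℝ (Fin n)) (ξ : ℝ) : Prop :=
  (symbol A t η ξ).det = 0

/-- Strict hyperbolicity, with real roots `τ_1 < ⋯ < τ_N`, analytic on `ℝ^d \ {0}`. The values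
of the functions `τ k` at the origin are irrelevant. -/
structure StrictlyHyperbolic (A : Fin (n + 1) → Matrix (Fin N) (Fin N) ℝ)
    (τ : Fin N → SpaceFreq n → ℝ) : Prop where
  strictMono : ∀ x : SpaceFreq n, x ≠ 0 → StrictMono (fun k => τ k x)
  analytic : ∀ k, AnalyticOnNhd ℝ (τ k) {0}ᶜ
  factor : ∀ (η : EuclideanSpace ℝ (Fin n)) (ξ : ℝ), (η, ξ) ≠ 0 → ∀ t : ℝ,
    (symbol A t η ξ).det = ∏ k, (t - τ k (η, ξ))

/-- The normal group velocity component `∂_ξ τ_k(η, ξ)`. -/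
def dxi (τ : Fin N → SpaceFreq n → ℝ) (k : Fin N) (η : EuclideanSpace ℝ (Fin n)) (ξ : ℝ) : ℝ :=
  deriv (fun s => τ k (η, s)) ξ

/-- For `(η, ξ) ≠ 0`, if `∂_ξ τ_k(η, ξ) = 0`, then `∂_ξ² τ_k(η, ξ) ≠ 0`. -/
def NondegenerateGlancing (τ : Fin N → SpaceFreq n → ℝ) : Prop :=
  ∀ (k : Fin N) (η : EuclideanSpace ℝ (Fin n)) (ξ : ℝ), (η, ξ) ≠ 0 →
    dxi τ k η ξ = 0 → deriv (fun s => dxi τ k η s) ξ ≠ 0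

/-- The glancing set `𝒢 ⊆ ℝ^d \ {0}`: the `ζ = (τ, η) ≠ 0` such that, for some real `ξ`,
`(ζ, ξ)` is characteristic and glancing. -/
def glancingSet (A : Fin (n + 1) → Matrix (Fin N) (Fin N) ℝ)
    (τ : Fin N → SpaceFreq n → ℝ) : Set (BdryFreq n) :=
  {ζ | ζ ≠ 0 ∧ ∃ ξ : ℝ, IsCharacteristic A ζ.fst ζ.snd ξ ∧
    ∃ k, ζ.fst = τ k (ζ.snd, ξ) ∧ dxi τ k ζ.snd ξ = 0}

/-- The operator on `ℂ^N` (with the Hermitian norm) defined by a real matrix. -/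
def complexOp (M : Matrix (Fin N) (Fin N) ℝ) :
    EuclideanSpace ℂ (Fin N) →ₗ[ℂ] EuclideanSpace ℂ (Fin N) :=
  Matrix.toEuclideanLin (M.map (algebraMap ℝ ℂ))

/-- `ker L(0, (τ_k(η, ξ), η, ξ)) ⊆ ℂ^N`. -/
def kerSpace (A : Fin (n + 1) → Matrix (Fin N) (Fin N) ℝ) (τ : Fin N → SpaceFreq n → ℝ)
    (η : EuclideanSpace ℝ (Fin n)) (ξ : ℝ) (k : Fin N) : Submodule ℂ (EuclideanSpace ℂ (Fin N)) :=
  LinearMap.ker (complexOp (symbol A (τ k (η, ξ)) η ξ))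

/-- `A_d(0)⁻¹ ker L(0, (τ_k(η, ξ), η, ξ)) ⊆ ℂ^N`. -/
def kerSpaceTilde (A : Fin (n + 1) → Matrix (Fin N) (Fin N) ℝ) (τ : Fin N → SpaceFreq n → ℝ)
    (η : EuclideanSpace ℝ (Fin n)) (ξ : ℝ) (k : Fin N) : Submodule ℂ (EuclideanSpace ℂ (Fin N)) :=
  (kerSpace A τ η ξ k).map (complexOp (A (Fin.last n))⁻¹)

open Classical in
/-- The projector of a vector space onto the `k`-th member of a family of subspaces, along the sum
of the other members (`0` if these are not complementary; see `isCompl_kerSpaceTilde`). -/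
def projOnto {ι E : Type*} [AddCommGroup E] [Module ℂ E] (V : ι → Submodule ℂ E) (k : ι) :
    E →ₗ[ℂ] E :=
  if h : IsCompl (V k) (⨆ (j) (_ : j ≠ k), V j) then (V k).projection _ h else 0

/-- The projector `π̃_k(η, ξ)` onto the `k`-th summand of
`ℂ^N = ⨁_j A_d(0)⁻¹ ker L(0, (τ_j(η, ξ), η, ξ))`. -/
def piTilde (A : Fin (n + 1) → Matrix (Fin N) (Fin N) ℝ) (τ : Fin N → SpaceFreq n → ℝ)
    (η : EuclideanSpace ℝ (Fin n)) (ξ : ℝ) (k : Fin N) :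
    EuclideanSpace ℂ (Fin N) →ₗ[ℂ] EuclideanSpace ℂ (Fin N) :=
  projOnto (kerSpaceTilde A τ η ξ) k

open Classical in
/-- The projector `π̃_α`, `α = (t, η, ξ)`: the identity if `α = 0`, `π̃_k(η, ξ)` if `α ≠ 0` is
characteristic with `t = τ_k(η, ξ)`, and `0` if `α` is not characteristic. -/
def piTildeFreq (A : Fin (n + 1) → Matrix (Fin N) (Fin N) ℝ) (τ : Fin N → SpaceFreq n → ℝ)
    (t : ℝ) (η : EuclideanSpace ℝ (Fin n)) (ξ : ℝ) :
    EuclideanSpace ℂ (Fin N) →ₗ[ℂ] EuclideanSpace ℂ (Fin N) :=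
  if (t, η, ξ) = (0 : ℝ × EuclideanSpace ℝ (Fin n) × ℝ) then LinearMap.id
  else if h : IsCharacteristic A t η ξ ∧ ∃ k, t = τ k (η, ξ) then
    piTilde A τ η ξ h.2.choose
  else 0

theorem mem_kerSpace_iff (A : Fin (n + 1) → Matrix (Fin N) (Fin N) ℝ)
    (τ : Fin N → SpaceFreq n → ℝ) (η : EuclideanSpace ℝ (Fin n)) (ξ : ℝ) (k : Fin N)
    (v : EuclideanSpace ℂ (Fin N)) :
    v ∈ kerSpace A τ η ξ k ↔
      complexOp (spatialSymbol A η ξ) v = (-(τ k (η, ξ) : ℂ)) • v := by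
  have h : complexOp (symbol A (τ k (η, ξ)) η ξ) v
      = (τ k (η, ξ) : ℂ) • v + complexOp (spatialSymbol A η ξ) v := by
    have hM : (symbol A (τ k (η, ξ)) η ξ).map (algebraMap ℝ ℂ)
        = (τ k (η, ξ) : ℂ) • (1 : Matrix (Fin N) (Fin N) ℂ)
          + (spatialSymbol A η ξ).map (algebraMap ℝ ℂ) := by
      ext i j
      by_cases hij : i = j <;> simp [symbol, hij]
    simp only [complexOp, hM, map_add, map_smul, LinearMap.add_apply, LinearMap.smul_apply,
      Matrix.toLpLin_one, LinearMap.id_apply]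
  rw [kerSpace, LinearMap.mem_ker, h, neg_smul, add_comm]
  exact add_eq_zero_iff_eq_neg

/-- Under strict hyperbolicity, `ℂ^N` is the direct sum of the lines `ker L(0, (τ_k, η, ξ))`. -/
theorem kerSpace_indep_and_top {A : Fin (n + 1) → Matrix (Fin N) (Fin N) ℝ}
    {τ : Fin N → SpaceFreq n → ℝ} (hτ : StrictlyHyperbolic A τ)
    {η : EuclideanSpace ℝ (Fin n)} {ξ : ℝ} (hx : (η, ξ) ≠ 0) :
    iSupIndep (kerSpace A τ η ξ) ∧ ⨆ k, kerSpace A τ η ξ k = ⊤ := by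
  have hinj : Function.Injective (fun k => (-(τ k (η, ξ) : ℂ))) := by
    intro j k hjk
    exact (hτ.strictMono _ hx).injective (by simpa using hjk)
  have heq : kerSpace A τ η ξ
      = (Module.End.eigenspace (complexOp (spatialSymbol A η ξ))) ∘
          (fun k => (-(τ k (η, ξ) : ℂ))) := by
    funext k
    ext v
    rw [mem_kerSpace_iff, Function.comp_apply, Module.End.mem_eigenspace_iff]
  have hind : iSupIndep (kerSpace A τ η ξ) := by
    rw [heq]
    exact (Module.End.eigenspaces_iSupIndep _).comp hinj
  refine ⟨hind, ?_⟩
  have hne : ∀ k, ∃ v ∈ kerSpace A τ η ξ k, v ≠ 0 := by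
    intro k
    have hdet : ((symbol A (τ k (η, ξ)) η ξ).map (algebraMap ℝ ℂ)).det = 0 := by
      have h0 : (symbol A (τ k (η, ξ)) η ξ).det = 0 := by
        rw [hτ.factor η ξ hx]
        exact Finset.prod_eq_zero (Finset.mem_univ k) (sub_self _)
      have h1 := RingHom.map_det (algebraMap ℝ ℂ) (symbol A (τ k (η, ξ)) η ξ)
      rw [h0, map_zero] at h1
      exact h1.symm
    obtain ⟨v, hv, hv0⟩ := Matrix.exists_mulVec_eq_zero_iff.mpr hdet
    refine ⟨WithLp.toLp 2 v, ?_, fun h => hv (by simpa using h)⟩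
    rw [kerSpace, LinearMap.mem_ker, complexOp, Matrix.toLpLin_toLp, Matrix.toLin'_apply, hv0]
    rfl
  choose v hv hv0 using hne
  have hli : LinearIndependent ℂ v := hind.linearIndependent _ hv hv0
  have hspan := hli.span_eq_top_of_card_eq_finrank' (by simp)
  rw [eq_top_iff, ← hspan, Submodule.span_le]
  rintro _ ⟨k, rfl⟩
  exact Submodule.mem_iSup_of_mem k (hv k)

/-- Under strict hyperbolicity and invertibility of `A_d(0)`, the subspaces defining `π̃_k(η, ξ)`
are complementary, so that `π̃_k(η, ξ)` is the genuine projector. -/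
theorem isCompl_kerSpaceTilde {A : Fin (n + 1) → Matrix (Fin N) (Fin N) ℝ}
    {τ : Fin N → SpaceFreq n → ℝ} (hA : IsUnit (A (Fin.last n))) (hτ : StrictlyHyperbolic A τ)
    {η : EuclideanSpace ℝ (Fin n)} {ξ : ℝ} (hx : (η, ξ) ≠ 0) (k : Fin N) :
    IsCompl (kerSpaceTilde A τ η ξ k) (⨆ (j) (_ : j ≠ k), kerSpaceTilde A τ η ξ j) := by
  have hmul : ∀ M M' : Matrix (Fin N) (Fin N) ℝ, M * M' = 1 →
      ∀ v, complexOp M (complexOp M' v) = v := by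
    intro M M' h v
    have h1 : M.map (algebraMap ℝ ℂ) * M'.map (algebraMap ℝ ℂ) = 1 := by
      rw [← Matrix.map_mul, h]
      simp
    apply WithLp.ofLp_injective
    simp only [complexOp, Matrix.ofLp_toLpLin, Matrix.toLin'_apply, Matrix.mulVec_mulVec, h1,
      Matrix.one_mulVec]
  have hdet : IsUnit (A (Fin.last n)).det := (Matrix.isUnit_iff_isUnit_det _).mp hA
  have hinj : Function.Injective (complexOp (A (Fin.last n))⁻¹) :=
    Function.LeftInverse.injective (hmul _ _ (Matrix.mul_nonsing_inv _ hdet))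
  have hsurj : Function.Surjective (complexOp (A (Fin.last n))⁻¹) :=
    Function.RightInverse.surjective (hmul _ _ (Matrix.nonsing_inv_mul _ hdet))
  obtain ⟨hind, htop⟩ := kerSpace_indep_and_top hτ hx
  have hind' : iSupIndep (kerSpaceTilde A τ η ξ) := LinearMap.iSupIndep_map _ hinj hind
  have htop' : ⨆ k, kerSpaceTilde A τ η ξ k = ⊤ := by
    simp only [kerSpaceTilde]
    rw [← Submodule.map_iSup, htop, Submodule.map_top, LinearMap.range_eq_top]
    exact hsurj
  refine ⟨hind' k, codisjoint_iff.mpr (eq_top_iff.mpr ?_)⟩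
  rw [← htop']
  refine iSup_le fun j => ?_
  by_cases hj : j = k
  · subst hj
    exact le_sup_left
  · exact le_sup_of_le_right (le_iSup₂_of_le j hj le_rfl)

end HypBVP

end

/-! The first bound amounts to `dist((τ, η), 𝒢) ≤ C |∂_ξ τ_k|² |(τ, η)|`. The roots are homogeneous
of degree 1, `∂_ξ τ_k` is homogeneous of degree 0 and `𝒢` is a cone, so it suffices to work on the
unit sphere of `(η, ξ)`, and by compactness near each of its points. There `(τ_k, η)` stays away
from 0, because `A_d(0)` is invertible. At a nonglancing point, continuity suffices. At a glancing
point, `∂_ξ² τ_k ≠ 0` makes `∂_ξ τ_k` strictly monotone along each nearby fibre of fixed `η`, with a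
zero `s` at distance `O(|∂_ξ τ_k|)`. The mean value theorem then gives `|τ_k(η, ξ) - τ_k(η, s)| =
O(|∂_ξ τ_k|²)`, and `(τ_k(η, s), η)` is in `𝒢` (`eventually_exists_critical`, `exists_infDist_le`).

The second bound reduces to the first through `π̃_k v = -∂_ξ τ_k A_d⁻¹ v` on `ker L`
(`piTilde_apply`). Indeed `v + ∂_ξ τ_k A_d⁻¹ v = A_d⁻¹ (∂_ξ τ_k + A_d) v`, and `(∂_ξ τ_k + A_d) v`
lies in the sum of the other kernels. This follows from `adj L (∂_ξ τ_k + A_d) adj L = 0`, where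
`adj L` is a nonzero multiple of the spectral projector onto `ker L`. -/

open Filter Topology

namespace HypBVP

/-! ### Nondegenerate critical points along fibres -/

/-- A primitive `T` of a function `F` growing at rate at least `m` is quadratically close, in terms
of `F`, to its value at the zero of `F`. -/
theorem exists_zero_abs_sub_le_sq {T F : ℝ → ℝ} {a b m : ℝ} (hab : a ≤ b) (hm : 0 < m)
    (hT : ∀ s ∈ Set.Icc a b, HasDerivAt T (F s) s)
    (hF : ContinuousOn F (Set.Icc a b))
    (hgrow : ∀ x ∈ Set.Icc a b, ∀ y ∈ Set.Icc a b, x ≤ y → m * (y - x) ≤ F y - F x)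
    (ha : F a ≤ 0) (hb : 0 ≤ F b) {x : ℝ} (hx : x ∈ Set.Icc a b) :
    ∃ s ∈ Set.Icc a b, F s = 0 ∧ |T x - T s| ≤ F x ^ 2 / m := by
  obtain ⟨s, hs, hs0⟩ := intermediate_value_Icc hab hF ⟨ha, hb⟩
  refine ⟨s, hs, hs0, ?_⟩
  have hsub : Set.uIcc s x ⊆ Set.Icc a b := Set.uIcc_subset_Icc hs hx
  -- `F` increases and vanishes at `s`, so between `s` and `x` its absolute value is largest at `x`.
  have hbound : ∀ c ∈ Set.uIcc s x, |F c| ≤ |F x| := by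
    intro c hc
    have hc' := hsub hc
    rcases Set.mem_uIcc.mp hc with ⟨h1, h2⟩ | ⟨h1, h2⟩
    · have e1 := hgrow s hs c hc' h1
      have e2 := hgrow c hc' x hx h2
      have e3 := mul_nonneg hm.le (sub_nonneg.mpr h1)
      have e4 := mul_nonneg hm.le (sub_nonneg.mpr h2)
      rw [abs_of_nonneg (by linarith), abs_of_nonneg (by linarith)]
      linarith
    · have e1 := hgrow c hc' s hs h2
      have e2 := hgrow x hx c hc' h1
      have e3 := mul_nonneg hm.le (sub_nonneg.mpr h1)
      have e4 := mul_nonneg hm.le (sub_nonneg.mpr h2)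
      rw [abs_of_nonpos (by linarith), abs_of_nonpos (by linarith)]
      linarith
  have hdist : m * |x - s| ≤ |F x| := by
    rcases le_total s x with h | h
    · have e1 := hgrow s hs x hx h
      rw [abs_of_nonneg (sub_nonneg.mpr h)]
      exact le_trans (by linarith) (le_abs_self _)
    · have e1 := hgrow x hx s hs h
      rw [abs_of_nonpos (sub_nonpos.mpr h)]
      exact le_trans (by linarith) (neg_le_abs _)
  have hmv : |T x - T s| ≤ |F x| * |x - s| := by
    have := (convex_uIcc s x).norm_image_sub_le_of_norm_hasDerivWithin_le (f := T) (f' := F)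
      (C := |F x|) (fun c hc => (hT c (hsub hc)).hasDerivWithinAt) hbound
      Set.left_mem_uIcc Set.right_mem_uIcc
    simpa [Real.norm_eq_abs] using this
  rw [le_div_iff₀ hm]
  calc |T x - T s| * m ≤ |F x| * |x - s| * m := by gcongr
    _ = |F x| * (m * |x - s|) := by ring
    _ ≤ |F x| * |F x| := by gcongr
    _ = F x ^ 2 := by rw [← sq, sq_abs]

variable {E : Type*} [NormedAddCommGroup E]

theorem analyticAt_deriv_snd [NormedSpace ℝ E] {g : E × ℝ → ℝ} {x : E × ℝ}
    (hg : AnalyticAt ℝ g x) :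
    AnalyticAt ℝ (fun y : E × ℝ => deriv (fun s => g (y.1, s)) y.2) x := by
  have h1 : AnalyticAt ℝ (fun y => fderiv ℝ g y (0, 1)) x :=
    ((ContinuousLinearMap.apply ℝ ℝ ((0, 1) : E × ℝ)).analyticAt _).comp hg.fderiv
  refine h1.congr ?_
  filter_upwards [hg.eventually_analyticAt] with y hy
  have h2 : HasDerivAt (fun s : ℝ => (y.1, s)) ((0, 1) : E × ℝ) y.2 :=
    (hasDerivAt_const _ _).prodMk (hasDerivAt_id _)
  exact (HasFDerivAt.comp_hasDerivAt (f := fun s : ℝ => (y.1, s)) y.2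
    hy.differentiableAt.hasFDerivAt h2).deriv.symm

theorem hasDerivAt_snd [NormedSpace ℝ E] {g : E × ℝ → ℝ} {x : E × ℝ} (hg : AnalyticAt ℝ g x) :
    HasDerivAt (fun s => g (x.1, s)) (deriv (fun s => g (x.1, s)) x.2) x.2 := by
  have h2 : HasDerivAt (fun s : ℝ => (x.1, s)) ((0, 1) : E × ℝ) x.2 :=
    (hasDerivAt_const _ _).prodMk (hasDerivAt_id _)
  exact (HasFDerivAt.comp_hasDerivAt (f := fun s : ℝ => (x.1, s)) x.2
    hg.differentiableAt.hasFDerivAt h2).differentiableAt.hasDerivAt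

/-- Near a nondegenerate critical point in the last variable of a function `T`, the fibrewise
critical value is at distance `O(F ^ 2)` of `T`, where `F` is the last partial derivative. -/
theorem eventually_exists_critical_of_pos {T F H : E × ℝ → ℝ} {x₀ : E × ℝ} {V : Set (E × ℝ)}
    (hV : V ∈ 𝓝 x₀)
    (hT : ∀ x ∈ V, HasDerivAt (fun s => T (x.1, s)) (F x) x.2)
    (hF : ∀ x ∈ V, HasDerivAt (fun s => F (x.1, s)) (H x) x.2)
    (hFc : ContinuousOn F V) (hH : ContinuousAt H x₀) (h0 : F x₀ = 0) (hpos : 0 < H x₀) :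
    ∃ C : ℝ, ∀ᶠ x in 𝓝 x₀, ∃ s, (x.1, s) ∈ V ∧ F (x.1, s) = 0 ∧
      |T x - T (x.1, s)| ≤ C * F x ^ 2 := by
  obtain ⟨η₀, ξ₀⟩ := x₀
  set m := H (η₀, ξ₀) / 2 with hm_def
  have hm : 0 < m := by positivity
  have hev : ∀ᶠ x in 𝓝 (η₀, ξ₀), x ∈ V ∧ m < H x :=
    (Filter.eventually_mem_set.mpr hV).and
      (hH.eventually (lt_mem_nhds (by rw [hm_def]; linarith)))
  obtain ⟨ε, hε, hball⟩ := Metric.eventually_nhds_iff_ball.mp hev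
  rw [← ball_prod_same] at hball
  set δ := ε / 2
  have hδ : 0 < δ := by positivity
  have hIcc : ∀ s ∈ Set.Icc (ξ₀ - δ) (ξ₀ + δ), s ∈ Metric.ball ξ₀ ε := by
    intro s hs
    rw [Real.ball_eq_Ioo]
    have : δ < ε := half_lt_self hε
    exact ⟨by linarith [hs.1], by linarith [hs.2]⟩
  have hgrow : ∀ η ∈ Metric.ball η₀ ε, ∀ x ∈ Set.Icc (ξ₀ - δ) (ξ₀ + δ),
      ∀ y ∈ Set.Icc (ξ₀ - δ) (ξ₀ + δ), x ≤ y → m * (y - x) ≤ F (η, y) - F (η, x) := by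
    intro η hη
    have hd : ∀ s ∈ Set.Icc (ξ₀ - δ) (ξ₀ + δ),
        HasDerivAt (fun s => F (η, s)) (H (η, s)) s := fun s hs =>
      hF (η, s) (hball (η, s) ⟨hη, hIcc s hs⟩).1
    refine (convex_Icc (ξ₀ - δ) (ξ₀ + δ)).mul_sub_le_image_sub_of_le_deriv
      (f := fun s => F (η, s)) (fun s hs => (hd s hs).continuousAt.continuousWithinAt)
      (fun s hs => (hd s (interior_subset hs)).differentiableAt.differentiableWithinAt) ?_
    intro s hs
    rw [(hd s (interior_subset hs)).deriv]
    exact (hball (η, s) ⟨hη, hIcc s (interior_subset hs)⟩).2.le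
  have hη₀ : η₀ ∈ Metric.ball η₀ ε := Metric.mem_ball_self hε
  have ml : ξ₀ - δ ∈ Set.Icc (ξ₀ - δ) (ξ₀ + δ) := ⟨le_rfl, by linarith⟩
  have mc : ξ₀ ∈ Set.Icc (ξ₀ - δ) (ξ₀ + δ) := ⟨by linarith, by linarith⟩
  have mr : ξ₀ + δ ∈ Set.Icc (ξ₀ - δ) (ξ₀ + δ) := ⟨by linarith, le_rfl⟩
  have hcont : ∀ s ∈ Set.Icc (ξ₀ - δ) (ξ₀ + δ), ContinuousAt (fun η => F (η, s)) η₀ := by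
    intro s hs
    have hnhds : V ∈ 𝓝 (η₀, s) := by
      refine Filter.mem_of_superset ?_ (fun x hx => (hball x hx).1)
      exact (Metric.isOpen_ball.prod Metric.isOpen_ball).mem_nhds ⟨hη₀, hIcc s hs⟩
    exact (hFc.continuousAt hnhds).comp (f := fun η => (η, s)) (by fun_prop)
  have hmδ : 0 < m * δ := by positivity
  -- Strict signs at the two ends of the fibre over `η₀` persist for `η` near `η₀`, so a single
  -- interval contains a zero for every such `η`.
  have hneg : F (η₀, ξ₀ - δ) < 0 := by
    have := hgrow η₀ hη₀ _ ml _ mc (by linarith)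
    rw [h0, show ξ₀ - (ξ₀ - δ) = δ by ring] at this
    linarith
  have hposr : 0 < F (η₀, ξ₀ + δ) := by
    have := hgrow η₀ hη₀ _ mc _ mr (by linarith)
    rw [h0, show ξ₀ + δ - ξ₀ = δ by ring] at this
    linarith
  have hevη : ∀ᶠ η in 𝓝 η₀, η ∈ Metric.ball η₀ ε ∧ F (η, ξ₀ - δ) < 0 ∧ 0 < F (η, ξ₀ + δ) :=
    (Filter.eventually_mem_set.mpr (Metric.ball_mem_nhds η₀ hε)).and
      (((hcont _ ml).eventually (gt_mem_nhds hneg)).and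
        ((hcont _ mr).eventually (lt_mem_nhds hposr)))
  have hevξ : ∀ᶠ ξ in 𝓝 ξ₀, ξ ∈ Set.Icc (ξ₀ - δ) (ξ₀ + δ) :=
    Icc_mem_nhds (by linarith) (by linarith)
  refine ⟨1 / m, ?_⟩
  rw [nhds_prod_eq]
  filter_upwards [hevη.prod_mk hevξ]
  rintro ⟨η, ξ⟩ ⟨⟨hη, hl, hr⟩, hξ⟩
  have hmem : ∀ s ∈ Set.Icc (ξ₀ - δ) (ξ₀ + δ), (η, s) ∈ V := fun s hs =>
    (hball (η, s) ⟨hη, hIcc s hs⟩).1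
  obtain ⟨s, hs, hs0, hle⟩ := exists_zero_abs_sub_le_sq (T := fun s => T (η, s))
    (F := fun s => F (η, s)) (by linarith) hm (fun s hs => hT _ (hmem s hs))
    (fun s hs => (hF _ (hmem s hs)).continuousAt.continuousWithinAt) (hgrow η hη) hl.le hr.le hξ
  exact ⟨s, hmem s hs, hs0, hle.trans_eq (by ring)⟩

/-- Negating `T`, `F` and `H` reverses the sign of `H` and changes neither side of the estimate. -/
theorem eventually_exists_critical {T F H : E × ℝ → ℝ} {x₀ : E × ℝ} {V : Set (E × ℝ)}
    (hV : V ∈ 𝓝 x₀)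
    (hT : ∀ x ∈ V, HasDerivAt (fun s => T (x.1, s)) (F x) x.2)
    (hF : ∀ x ∈ V, HasDerivAt (fun s => F (x.1, s)) (H x) x.2)
    (hFc : ContinuousOn F V) (hH : ContinuousAt H x₀) (h0 : F x₀ = 0) (hne : H x₀ ≠ 0) :
    ∃ C : ℝ, ∀ᶠ x in 𝓝 x₀, ∃ s, (x.1, s) ∈ V ∧ F (x.1, s) = 0 ∧
      |T x - T (x.1, s)| ≤ C * F x ^ 2 := by
  rcases hne.lt_or_gt with h | h
  · obtain ⟨C, hC⟩ := eventually_exists_critical_of_pos (T := fun x => -T x) (F := fun x => -F x)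
      (H := fun x => -H x) hV (fun x hx => (hT x hx).neg) (fun x hx => (hF x hx).neg)
      hFc.neg hH.neg (by simp [h0]) (by linarith)
    refine ⟨C, hC.mono ?_⟩
    rintro x ⟨s, hs, hs0, hle⟩
    refine ⟨s, hs, by simpa using hs0, ?_⟩
    rw [neg_sq, ← abs_neg] at hle
    convert hle using 2
    ring
  · exact eventually_exists_critical_of_pos hV hT hF hFc hH h0 h

/-! ### Homogeneity of the roots and of the glancing set -/

variable {n N : ℕ} {A : Fin (n + 1) → Matrix (Fin N) (Fin N) ℝ} {τ : Fin N → SpaceFreq n → ℝ}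

theorem symbol_smul (A : Fin (n + 1) → Matrix (Fin N) (Fin N) ℝ) (c t : ℝ)
    (η : EuclideanSpace ℝ (Fin n)) (ξ : ℝ) :
    symbol A (c * t) (c • η) (c * ξ) = c • symbol A t η ξ := by
  simp only [symbol, spatialSymbol, smul_add, Finset.smul_sum, smul_smul, PiLp.smul_apply,
    smul_eq_mul]

theorem isCharacteristic_smul {c : ℝ} (hc : c ≠ 0) {t : ℝ} {η : EuclideanSpace ℝ (Fin n)} {ξ : ℝ} :
    IsCharacteristic A (c * t) (c • η) (c * ξ) ↔ IsCharacteristic A t η ξ := by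
  simp [IsCharacteristic, symbol_smul, hc]

theorem StrictlyHyperbolic.isCharacteristic_iff (hτ : StrictlyHyperbolic A τ) {t : ℝ}
    {x : SpaceFreq n} (hx : x ≠ 0) :
    IsCharacteristic A t x.1 x.2 ↔ t ∈ Set.range (fun k => τ k x) := by
  rw [IsCharacteristic, hτ.factor x.1 x.2 hx, Finset.prod_eq_zero_iff]
  simp [sub_eq_zero, eq_comm]

/-- The characteristic set is a cone, so both sides list the roots at `c • x` in increasing order;
strictly increasing families with the same range coincide. -/
theorem StrictlyHyperbolic.smul (hτ : StrictlyHyperbolic A τ) {c : ℝ} (hc : 0 < c)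
    {x : SpaceFreq n} (hx : x ≠ 0) (k : Fin N) : τ k (c • x) = c * τ k x := by
  have hcx : c • x ≠ 0 := smul_ne_zero hc.ne' hx
  have hmono : StrictMono (fun k => c * τ k x) := fun i j hij =>
    mul_lt_mul_of_pos_left (hτ.strictMono x hx hij) hc
  refine congrFun (((hτ.strictMono _ hcx).range_inj hmono).mp ?_) k
  ext t
  have h1 : t = c * (c⁻¹ * t) := by field_simp
  rw [← hτ.isCharacteristic_iff hcx, Prod.smul_fst, Prod.smul_snd, smul_eq_mul]
  conv_lhs => rw [h1]
  rw [isCharacteristic_smul hc.ne', hτ.isCharacteristic_iff hx]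
  refine exists_congr fun j => ?_
  simp only
  rw [eq_inv_mul_iff_mul_eq₀ hc.ne']

theorem eventually_prodMk_ne_zero {x : SpaceFreq n} (hx : x ≠ 0) :
    ∀ᶠ s in 𝓝 x.2, ((x.1, s) : SpaceFreq n) ≠ 0 :=
  ContinuousAt.eventually_ne (g := fun s : ℝ => ((x.1, s) : SpaceFreq n)) (by fun_prop) hx

theorem StrictlyHyperbolic.hasDerivAt (hτ : StrictlyHyperbolic A τ) {x : SpaceFreq n}
    (hx : x ≠ 0) (k : Fin N) :
    HasDerivAt (fun s => τ k (x.1, s)) (dxi τ k x.1 x.2) x.2 :=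
  hasDerivAt_snd (hτ.analytic k x hx)

theorem StrictlyHyperbolic.dxi_smul (hτ : StrictlyHyperbolic A τ) {c : ℝ} (hc : 0 < c)
    {x : SpaceFreq n} (hx : x ≠ 0) (k : Fin N) :
    dxi τ k (c • x.1) (c * x.2) = dxi τ k x.1 x.2 := by
  have hcx : c • x ≠ 0 := smul_ne_zero hc.ne' hx
  have h1 : HasDerivAt (fun s => τ k (c • x.1, c * s)) (dxi τ k (c • x.1) (c * x.2) * c) x.2 :=
    HasDerivAt.comp (h₂ := fun s => τ k (c • x.1, s)) x.2 (hτ.hasDerivAt hcx k)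
      (by simpa using (hasDerivAt_id x.2).const_mul c)
  have h2 : HasDerivAt (fun s => τ k (c • x.1, c * s)) (c * dxi τ k x.1 x.2) x.2 := by
    refine ((hτ.hasDerivAt hx k).const_mul c).congr_of_eventuallyEq ?_
    filter_upwards [eventually_prodMk_ne_zero hx] with s hs
    exact hτ.smul hc hs k
  have h3 := h1.unique h2
  rw [mul_comm] at h3
  exact mul_left_cancel₀ hc.ne' h3

/-- The boundary frequency `(τ_k(x), η)` of `x = (η, ξ)`. -/
def bdryFreq (τ : Fin N → SpaceFreq n → ℝ) (k : Fin N) (x : SpaceFreq n) : BdryFreq n :=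
  WithLp.toLp 2 (τ k x, x.1)

theorem StrictlyHyperbolic.bdryFreq_smul (hτ : StrictlyHyperbolic A τ) {c : ℝ} (hc : 0 < c)
    {x : SpaceFreq n} (hx : x ≠ 0) (k : Fin N) :
    bdryFreq τ k (c • x) = c • bdryFreq τ k x := by
  simp only [bdryFreq, hτ.smul hc hx k, Prod.smul_fst, ← WithLp.toLp_smul, Prod.smul_mk,
    smul_eq_mul]

/-- If `τ_k` and `η` vanish, the symbol is `ξ A_d(0)` with `ξ ≠ 0`, which is invertible. -/
theorem StrictlyHyperbolic.bdryFreq_ne_zero (hA : IsUnit (A (Fin.last n)))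
    (hτ : StrictlyHyperbolic A τ) {x : SpaceFreq n} (hx : x ≠ 0) (k : Fin N) :
    bdryFreq τ k x ≠ 0 := by
  intro h
  have h1 : (τ k x, x.1) = (0 : ℝ × EuclideanSpace ℝ (Fin n)) := by
    simpa [bdryFreq] using h
  obtain ⟨ht, hη⟩ := Prod.mk_eq_zero.mp h1
  have hξ : x.2 ≠ 0 := fun h => hx (Prod.ext hη h)
  have hchar : IsCharacteristic A (τ k x) x.1 x.2 := (hτ.isCharacteristic_iff hx).mpr ⟨k, rfl⟩
  have hsym : symbol A (τ k x) x.1 x.2 = x.2 • A (Fin.last n) := by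
    simp [symbol, spatialSymbol, ht, hη]
  rw [IsCharacteristic, hsym, Matrix.det_smul] at hchar
  exact mul_ne_zero (pow_ne_zero _ hξ) ((Matrix.isUnit_iff_isUnit_det _).mp hA).ne_zero hchar

theorem StrictlyHyperbolic.bdryFreq_mem_glancingSet (hA : IsUnit (A (Fin.last n)))
    (hτ : StrictlyHyperbolic A τ) {x : SpaceFreq n} (hx : x ≠ 0) {k : Fin N}
    (h : dxi τ k x.1 x.2 = 0) : bdryFreq τ k x ∈ glancingSet A τ :=
  ⟨hτ.bdryFreq_ne_zero hA hx k, x.2, (hτ.isCharacteristic_iff hx).mpr ⟨k, rfl⟩, k, rfl, h⟩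

theorem StrictlyHyperbolic.smul_mem_glancingSet (hA : IsUnit (A (Fin.last n)))
    (hτ : StrictlyHyperbolic A τ) {c : ℝ} (hc : 0 < c) {ζ : BdryFreq n}
    (hζ : ζ ∈ glancingSet A τ) : c • ζ ∈ glancingSet A τ := by
  obtain ⟨h0, ξ, hchar, k, hk, hd⟩ := hζ
  have hx : ((ζ.snd, ξ) : SpaceFreq n) ≠ 0 := by
    intro hx
    obtain ⟨hη, hξ⟩ := Prod.mk_eq_zero.mp hx
    have ht : ζ.fst ≠ 0 := fun ht => h0 (WithLp.ofLp_injective 2 (Prod.ext ht hη))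
    rw [IsCharacteristic, hη, hξ] at hchar
    simp [symbol, spatialSymbol, ht] at hchar
  have h1 := hτ.bdryFreq_mem_glancingSet hA (x := c • ((ζ.snd, ξ) : SpaceFreq n))
    (smul_ne_zero hc.ne' hx) (k := k) ((hτ.dxi_smul hc hx k).trans hd)
  rw [hτ.bdryFreq_smul hc hx, bdryFreq, ← hk] at h1
  exact h1

/-- Scaling multiplies distances by `c`, and `c 𝒢 ⊆ 𝒢`. Nonemptiness matters because `infDist` to
the empty set is 0. -/
theorem StrictlyHyperbolic.infDist_smul_le (hA : IsUnit (A (Fin.last n)))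
    (hτ : StrictlyHyperbolic A τ) (hG : (glancingSet A τ).Nonempty) {c : ℝ} (hc : 0 < c)
    (ζ : BdryFreq n) :
    Metric.infDist (c • ζ) (glancingSet A τ) ≤ c * Metric.infDist ζ (glancingSet A τ) := by
  open scoped Pointwise in
  have h := infDist_smul₀ hc.ne' (glancingSet A τ) ζ
  rw [Real.norm_of_nonneg hc.le] at h
  rw [← h]
  refine Metric.infDist_le_infDist_of_subset ?_ hG.smul_set
  rintro _ ⟨ζ', hζ', rfl⟩
  exact hτ.smul_mem_glancingSet hA hc hζ'

theorem StrictlyHyperbolic.continuousAt_bdryFreq (hτ : StrictlyHyperbolic A τ) {x : SpaceFreq n}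
    (hx : x ≠ 0) (k : Fin N) : ContinuousAt (bdryFreq τ k) x := by
  have h := (hτ.analytic k x hx).continuousAt
  exact (WithLp.prod_continuous_toLp 2 ℝ (EuclideanSpace ℝ (Fin n))).continuousAt.comp
    (h.prodMk continuousAt_fst)

theorem dist_bdryFreq (k : Fin N) (η : EuclideanSpace ℝ (Fin n)) (ξ s : ℝ) :
    dist (bdryFreq τ k (η, ξ)) (bdryFreq τ k (η, s)) = |τ k (η, ξ) - τ k (η, s)| := by
  rw [WithLp.prod_dist_eq_of_L2]
  simp [bdryFreq, Real.sqrt_sq_eq_abs, Real.dist_eq]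

/-! ### Distance to the glancing set -/

theorem StrictlyHyperbolic.eventually_infDist_le (hA : IsUnit (A (Fin.last n)))
    (hτ : StrictlyHyperbolic A τ) (hmult : NondegenerateGlancing τ)
    {x₀ : SpaceFreq n} (hx₀ : x₀ ≠ 0) (k : Fin N) :
    ∃ C : ℝ, ∀ᶠ x in 𝓝 x₀,
      Metric.infDist (bdryFreq τ k x) (glancingSet A τ) ≤ C * dxi τ k x.1 x.2 ^ 2 := by
  set F : SpaceFreq n → ℝ := fun x => dxi τ k x.1 x.2 with hF_def
  have hF : ∀ x, x ≠ 0 → AnalyticAt ℝ F x := fun x hx => analyticAt_deriv_snd (hτ.analytic k x hx)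
  by_cases h0 : F x₀ = 0
  · set H : SpaceFreq n → ℝ := fun x => deriv (fun s => F (x.1, s)) x.2 with hH_def
    have hV : ({0}ᶜ : Set (SpaceFreq n)) ∈ 𝓝 x₀ := isOpen_compl_singleton.mem_nhds hx₀
    obtain ⟨C, hC⟩ := eventually_exists_critical (T := τ k) (F := F) (H := H) hV
      (fun x hx => hτ.hasDerivAt hx k) (fun x hx => hasDerivAt_snd (hF x hx))
      (fun x hx => (hF x hx).continuousAt.continuousWithinAt)
      (analyticAt_deriv_snd (hF x₀ hx₀)).continuousAt h0 (hmult k x₀.1 x₀.2 hx₀ h0)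
    refine ⟨C, hC.mono ?_⟩
    rintro ⟨η, ξ⟩ ⟨s, hs, hs0, hle⟩
    refine le_trans ?_ hle
    rw [← dist_bdryFreq]
    exact Metric.infDist_le_dist_of_mem (hτ.bdryFreq_mem_glancingSet hA hs hs0)
  · have hg : ContinuousAt (fun x => Metric.infDist (bdryFreq τ k x) (glancingSet A τ)) x₀ :=
      (Metric.continuous_infDist_pt _).continuousAt.comp (hτ.continuousAt_bdryFreq hx₀ k)
    have hq : ContinuousAt (fun x =>
        Metric.infDist (bdryFreq τ k x) (glancingSet A τ) / F x ^ 2) x₀ :=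
      hg.div ((hF x₀ hx₀).continuousAt.pow 2) (pow_ne_zero 2 h0)
    -- Near a nonglancing point the quotient is continuous, hence below its value at `x₀` plus one.
    refine ⟨Metric.infDist (bdryFreq τ k x₀) (glancingSet A τ) / F x₀ ^ 2 + 1, ?_⟩
    filter_upwards [hq.eventually (gt_mem_nhds (lt_add_one _)),
      (hF x₀ hx₀).continuousAt.eventually_ne h0] with x hx hne
    exact (div_le_iff₀ (by positivity)).mp hx.le

theorem StrictlyHyperbolic.exists_infDist_le (hA : IsUnit (A (Fin.last n)))
    (hτ : StrictlyHyperbolic A τ) (hmult : NondegenerateGlancing τ)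
    (hG : (glancingSet A τ).Nonempty) (k : Fin N) :
    ∃ C : ℝ, 0 ≤ C ∧ ∀ x : SpaceFreq n, x ≠ 0 →
      Metric.infDist (bdryFreq τ k x) (glancingSet A τ) ≤
        C * dxi τ k x.1 x.2 ^ 2 * ‖bdryFreq τ k x‖ := by
  have hsphere : ∃ C : ℝ, 0 ≤ C ∧ ∀ x ∈ Metric.sphere (0 : SpaceFreq n) 1,
      Metric.infDist (bdryFreq τ k x) (glancingSet A τ) ≤
        C * dxi τ k x.1 x.2 ^ 2 * ‖bdryFreq τ k x‖ := by
    refine (isCompact_sphere (0 : SpaceFreq n) 1).induction_on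
      (p := fun s => ∃ C : ℝ, 0 ≤ C ∧ ∀ x ∈ s,
        Metric.infDist (bdryFreq τ k x) (glancingSet A τ) ≤
          C * dxi τ k x.1 x.2 ^ 2 * ‖bdryFreq τ k x‖) ⟨0, le_rfl, by simp⟩ ?_ ?_ ?_
    · rintro s t hst ⟨C, hC, h⟩
      exact ⟨C, hC, fun x hx => h x (hst hx)⟩
    · rintro s t ⟨C, hC, h⟩ ⟨C', hC', h'⟩
      refine ⟨max C C', le_max_of_le_left hC, ?_⟩
      rintro x (hx | hx)
      · exact (h x hx).trans (by gcongr; exact le_max_left _ _)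
      · exact (h' x hx).trans (by gcongr; exact le_max_right _ _)
    · intro x₀ hx₀
      have hne : x₀ ≠ 0 := ne_zero_of_mem_unit_sphere ⟨x₀, hx₀⟩
      obtain ⟨C, hC⟩ := hτ.eventually_infDist_le hA hmult hne k
      have hpos : 0 < ‖bdryFreq τ k x₀‖ := norm_pos_iff.mpr (hτ.bdryFreq_ne_zero hA hne k)
      set r := ‖bdryFreq τ k x₀‖ / 2
      have hr : 0 < r := by positivity
      have hnear : ∀ᶠ x in 𝓝 x₀, r < ‖bdryFreq τ k x‖ :=
        (hτ.continuousAt_bdryFreq hne k).norm.eventually (lt_mem_nhds (half_lt_self hpos))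
      -- The local estimate lacks the factor `‖bdryFreq τ k x‖`; since this exceeds `r` near `x₀`,
      -- dividing the constant by `r` supplies it.
      refine ⟨_, mem_nhdsWithin_of_mem_nhds (hC.and hnear), |C| / r, by positivity, ?_⟩
      rintro x ⟨hx, hxr⟩
      calc _ ≤ C * dxi τ k x.1 x.2 ^ 2 := hx
        _ ≤ |C| * dxi τ k x.1 x.2 ^ 2 := by gcongr; exact le_abs_self C
        _ = |C| / r * dxi τ k x.1 x.2 ^ 2 * r := by field_simp
        _ ≤ _ := by gcongr
  obtain ⟨C, hC, h⟩ := hsphere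
  refine ⟨C, hC, fun x hx => ?_⟩
  obtain ⟨c, u, hc, hu1, rfl⟩ : ∃ (c : ℝ) (u : SpaceFreq n), 0 < c ∧
      u ∈ Metric.sphere (0 : SpaceFreq n) 1 ∧ c • u = x := by
    have hc : 0 < ‖x‖ := norm_pos_iff.mpr hx
    refine ⟨‖x‖, ‖x‖⁻¹ • x, hc, ?_, ?_⟩
    · rw [mem_sphere_zero_iff_norm, norm_smul, norm_inv, norm_norm, inv_mul_cancel₀ hc.ne']
    · rw [smul_smul, mul_inv_cancel₀ hc.ne', one_smul]
  have hu0 : u ≠ 0 := ne_zero_of_mem_unit_sphere ⟨u, hu1⟩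
  rw [hτ.bdryFreq_smul hc hu0, Prod.smul_fst, Prod.smul_snd, smul_eq_mul, hτ.dxi_smul hc hu0,
    norm_smul, Real.norm_of_nonneg hc.le]
  calc _ ≤ c * Metric.infDist (bdryFreq τ k u) (glancingSet A τ) :=
        hτ.infDist_smul_le hA hG hc _
    _ ≤ c * (C * dxi τ k u.1 u.2 ^ 2 * ‖bdryFreq τ k u‖) := by gcongr; exact h u hu1
    _ = _ := by ring

/-! ### The projector on the kernel of the symbol -/

theorem complexOp_mul (M M' : Matrix (Fin N) (Fin N) ℝ) (v : EuclideanSpace ℂ (Fin N)) :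
    complexOp (M * M') v = complexOp M (complexOp M' v) := by
  apply WithLp.ofLp_injective
  simp only [complexOp, Matrix.ofLp_toLpLin, Matrix.toLin'_apply, Matrix.mulVec_mulVec,
    Matrix.map_mul]

theorem complexOp_add (M M' : Matrix (Fin N) (Fin N) ℝ) :
    complexOp (M + M') = complexOp M + complexOp M' := by
  rw [complexOp, Matrix.map_add _ (by simp), map_add, complexOp, complexOp]

theorem complexOp_smul_one (c : ℝ) (v : EuclideanSpace ℂ (Fin N)) :
    complexOp (c • (1 : Matrix (Fin N) (Fin N) ℝ)) v = (c : ℂ) • v := by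
  have h : (c • (1 : Matrix (Fin N) (Fin N) ℝ)).map (algebraMap ℝ ℂ)
      = (c : ℂ) • (1 : Matrix (Fin N) (Fin N) ℂ) := by
    ext i j
    by_cases hij : i = j <;> simp [hij]
  rw [complexOp, h, map_smul, Matrix.toLpLin_one, LinearMap.smul_apply, LinearMap.id_apply]

theorem complexOp_zero : complexOp (0 : Matrix (Fin N) (Fin N) ℝ) = 0 := by
  simp [complexOp]

theorem complexOp_mul_eq_one {M M' : Matrix (Fin N) (Fin N) ℝ} (h : M * M' = 1)
    (v : EuclideanSpace ℂ (Fin N)) : complexOp M (complexOp M' v) = v := by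
  rw [← complexOp_mul, h, ← one_smul ℝ (1 : Matrix (Fin N) (Fin N) ℝ), complexOp_smul_one]
  simp

theorem continuous_complexOp_apply (v : EuclideanSpace ℂ (Fin N)) :
    Continuous fun M : Matrix (Fin N) (Fin N) ℝ => complexOp M v := by
  have h : Continuous fun M : Matrix (Fin N) (Fin N) ℝ =>
      (M.map (algebraMap ℝ ℂ)).mulVec v.ofLp :=
    (continuous_id.matrix_map (continuous_algebraMap ℝ ℂ)).matrix_mulVec continuous_const
  exact (PiLp.continuous_toLp 2 fun _ : Fin N => ℂ).comp h

theorem continuous_symbol (A : Fin (n + 1) → Matrix (Fin N) (Fin N) ℝ)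
    (η : EuclideanSpace ℝ (Fin n)) : Continuous fun p : ℝ × ℝ => symbol A p.1 η p.2 := by
  unfold symbol spatialSymbol
  fun_prop

theorem complexOp_symbol_of_mem_kerSpace {η : EuclideanSpace ℝ (Fin n)} {ξ : ℝ} {j : Fin N}
    {v : EuclideanSpace ℂ (Fin N)} (hv : v ∈ kerSpace A τ η ξ j) (t : ℝ) :
    complexOp (symbol A t η ξ) v = ((t - τ j (η, ξ) : ℝ) : ℂ) • v := by
  rw [symbol, complexOp_add, LinearMap.add_apply, complexOp_smul_one,
    (mem_kerSpace_iff A τ η ξ j v).mp hv, ← add_smul, Complex.ofReal_sub, sub_eq_add_neg]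

/-- The adjugate of the symbol is diagonal with respect to its eigenspaces. -/
theorem StrictlyHyperbolic.complexOp_adjugate (hτ : StrictlyHyperbolic A τ)
    {η : EuclideanSpace ℝ (Fin n)} {ξ : ℝ} (hx : (η, ξ) ≠ 0) {j : Fin N}
    {v : EuclideanSpace ℂ (Fin N)} (hv : v ∈ kerSpace A τ η ξ j) (t : ℝ) :
    complexOp (symbol A t η ξ).adjugate v
      = ((∏ i ∈ Finset.univ.erase j, (t - τ i (η, ξ)) : ℝ) : ℂ) • v := by
  have hL : Continuous fun t => complexOp (symbol A t η ξ).adjugate v :=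
    (continuous_complexOp_apply v).comp
      ((continuous_symbol A η).comp (by fun_prop : Continuous fun t : ℝ => (t, ξ))).matrix_adjugate
  have hR : Continuous fun t =>
      ((∏ i ∈ Finset.univ.erase j, (t - τ i (η, ξ)) : ℝ) : ℂ) • v := by fun_prop
  -- For `t ≠ τ_j`, cancel `t - τ_j` in `adj L · L v = det L · v`; continuity in `t` reaches the
  -- excluded value.
  refine congrFun (hL.ext_on (dense_compl_singleton (τ j (η, ξ))) hR fun t ht => ?_) t
  have hne : ((t - τ j (η, ξ) : ℝ) : ℂ) ≠ 0 := Complex.ofReal_ne_zero.mpr (sub_ne_zero.mpr ht)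
  refine smul_right_injective _ hne ?_
  simp only
  rw [← map_smul, ← complexOp_symbol_of_mem_kerSpace hv t, ← complexOp_mul,
    Matrix.adjugate_mul, complexOp_smul_one, hτ.factor η ξ hx t, smul_smul, ← Complex.ofReal_mul,
    Finset.mul_prod_erase _ (fun i => t - τ i (η, ξ)) (Finset.mem_univ j)]

/-- `adj L (∂_ξ τ_k + A_d) adj L = 0` at a characteristic point of the `k`-th sheet. -/
theorem StrictlyHyperbolic.adjugate_mul_mul_adjugate (hτ : StrictlyHyperbolic A τ)
    {η : EuclideanSpace ℝ (Fin n)} {ξ : ℝ} (hx : (η, ξ) ≠ 0) (k : Fin N) :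
    (symbol A (τ k (η, ξ)) η ξ).adjugate *
      (dxi τ k η ξ • (1 : Matrix (Fin N) (Fin N) ℝ) + A (Fin.last n)) *
      (symbol A (τ k (η, ξ)) η ξ).adjugate = 0 := by
  set L : ℝ → Matrix (Fin N) (Fin N) ℝ := fun s => symbol A (τ k (η, s)) η s with hL_def
  have hder := hτ.hasDerivAt hx k
  have hdet : ∀ s, (η, s) ≠ 0 → (L s).det = 0 := fun s hs =>
    (hτ.isCharacteristic_iff hs).mpr ⟨k, rfl⟩
  have hLc : ContinuousAt L ξ :=
    (continuous_symbol A η).continuousAt.comp (f := fun s => (τ k (η, s), s))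
      (hder.continuousAt.prodMk continuousAt_id)
  have hMc : ContinuousAt (fun s => (L s).adjugate) ξ :=
    (continuous_id.matrix_adjugate).continuousAt.comp hLc
  -- The middle factor is the limit of `(L s - L ξ) / (s - ξ)`. Between `adj (L ξ)` and `adj (L s)`
  -- this quotient gives 0, since both determinants vanish.
  have hlim : Tendsto (fun s => (L ξ).adjugate *
      (slope (fun s => τ k (η, s)) ξ s • (1 : Matrix (Fin N) (Fin N) ℝ) + A (Fin.last n)) *
      (L s).adjugate) (𝓝[≠] ξ) (𝓝 ((L ξ).adjugate *
      (dxi τ k η ξ • (1 : Matrix (Fin N) (Fin N) ℝ) + A (Fin.last n)) * (L ξ).adjugate)) :=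
    (tendsto_const_nhds.mul ((hder.tendsto_slope.smul_const _).add_const _)).mul
      (hMc.tendsto.mono_left nhdsWithin_le_nhds)
  refine tendsto_nhds_unique hlim (tendsto_const_nhds.congr' ?_)
  filter_upwards [self_mem_nhdsWithin,
    mem_nhdsWithin_of_mem_nhds (eventually_prodMk_ne_zero hx)] with s hs hs0
  have hsub : s - ξ ≠ 0 := sub_ne_zero.mpr hs
  have hslope : slope (fun s => τ k (η, s)) ξ s • (1 : Matrix (Fin N) (Fin N) ℝ) + A (Fin.last n)
      = (s - ξ)⁻¹ • (L s - L ξ) := by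
    have h1 : L s - L ξ = (τ k (η, s) - τ k (η, ξ)) • (1 : Matrix (Fin N) (Fin N) ℝ)
        + (s - ξ) • A (Fin.last n) := by
      simp only [hL_def, symbol, spatialSymbol, sub_smul]
      abel
    rw [h1, smul_add, smul_smul, smul_smul, inv_mul_cancel₀ hsub, one_smul, slope_def_field,
      div_eq_inv_mul]
  rw [hslope, Matrix.mul_smul, Matrix.smul_mul, mul_sub, sub_mul, Matrix.adjugate_mul, hdet ξ hx,
    mul_assoc, Matrix.mul_adjugate, hdet s hs0]
  simp

/-- At `t = τ_k` the adjugate kills the other kernels and acts on the `k`-th as `∏ (τ_k - τ_i)`,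
nonzero because the roots are distinct. -/
theorem StrictlyHyperbolic.mem_iSup_kerSpace_of_adjugate (hτ : StrictlyHyperbolic A τ)
    {η : EuclideanSpace ℝ (Fin n)} {ξ : ℝ} (hx : (η, ξ) ≠ 0) {k : Fin N}
    {w : EuclideanSpace ℂ (Fin N)}
    (hw : complexOp (symbol A (τ k (η, ξ)) η ξ).adjugate w = 0) :
    w ∈ ⨆ (j) (_ : j ≠ k), kerSpace A τ η ξ j := by
  have htop : w ∈ kerSpace A τ η ξ k ⊔ ⨆ (j) (_ : j ≠ k), kerSpace A τ η ξ j := by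
    refine (iSup_le fun j => ?_ :
      ⨆ j, kerSpace A τ η ξ j ≤ _) ((kerSpace_indep_and_top hτ hx).2 ▸ Submodule.mem_top)
    by_cases hj : j = k
    · exact hj ▸ le_sup_left
    · exact le_sup_of_le_right (le_iSup₂_of_le j hj le_rfl)
  obtain ⟨a, ha, b, hb, rfl⟩ := Submodule.mem_sup.mp htop
  have hb0 : complexOp (symbol A (τ k (η, ξ)) η ξ).adjugate b = 0 := by
    have hle : ⨆ (j) (_ : j ≠ k), kerSpace A τ η ξ j
        ≤ LinearMap.ker (complexOp (symbol A (τ k (η, ξ)) η ξ).adjugate) := by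
      refine iSup₂_le fun j hj v hv => ?_
      rw [LinearMap.mem_ker, hτ.complexOp_adjugate hx hv,
        Finset.prod_eq_zero (Finset.mem_erase.mpr ⟨hj.symm, Finset.mem_univ k⟩) (sub_self _)]
      simp
    exact hle hb
  rw [map_add, hb0, add_zero, hτ.complexOp_adjugate hx ha] at hw
  have hne : (∏ i ∈ Finset.univ.erase k, (τ k (η, ξ) - τ i (η, ξ))) ≠ 0 :=
    Finset.prod_ne_zero_iff.mpr fun i hi => sub_ne_zero.mpr
      ((hτ.strictMono _ hx).injective.ne (Finset.ne_of_mem_erase hi).symm)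
  rw [(smul_eq_zero.mp hw).resolve_left (Complex.ofReal_ne_zero.mpr hne), zero_add]
  exact hb

theorem projOnto_eq {ι E : Type*} [AddCommGroup E] [Module ℂ E] {V : ι → Submodule ℂ E} {k : ι}
    (h : IsCompl (V k) (⨆ (j) (_ : j ≠ k), V j)) {v u : E} (hu : u ∈ V k)
    (hvu : v - u ∈ ⨆ (j) (_ : j ≠ k), V j) : projOnto V k v = u := by
  rw [projOnto, dif_pos h, ← sub_add_cancel v u, map_add,
    (Submodule.projection_apply_eq_zero_iff h).mpr hvu,
    Submodule.projection_apply_of_mem_left h hu, zero_add]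

/-- On `ker L`, the projector `π̃_k` is `-∂_ξ τ_k A_d⁻¹`. -/
theorem StrictlyHyperbolic.piTilde_apply (hA : IsUnit (A (Fin.last n)))
    (hτ : StrictlyHyperbolic A τ) {η : EuclideanSpace ℝ (Fin n)} {ξ : ℝ} (hx : (η, ξ) ≠ 0)
    {k : Fin N} {v : EuclideanSpace ℂ (Fin N)} (hv : v ∈ kerSpace A τ η ξ k) :
    piTilde A τ η ξ k v
      = (-(dxi τ k η ξ : ℂ)) • complexOp (A (Fin.last n))⁻¹ v := by
  have hdet : IsUnit (A (Fin.last n)).det := (Matrix.isUnit_iff_isUnit_det _).mp hA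
  refine projOnto_eq (isCompl_kerSpaceTilde hA hτ hx k)
    (Submodule.smul_mem _ _ (Submodule.mem_map_of_mem hv)) ?_
  set w := complexOp (dxi τ k η ξ • (1 : Matrix (Fin N) (Fin N) ℝ) + A (Fin.last n)) v with hw_def
  have hw : complexOp (symbol A (τ k (η, ξ)) η ξ).adjugate w = 0 := by
    have h := congrArg (fun M => complexOp M v) (hτ.adjugate_mul_mul_adjugate hx k)
    simp only [complexOp_zero, LinearMap.zero_apply] at h
    -- The rightmost adjugate acts on `v` as a nonzero scalar, which can be cancelled.
    rw [complexOp_mul, hτ.complexOp_adjugate hx hv, map_smul, complexOp_mul] at h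
    have hne : (∏ i ∈ Finset.univ.erase k, (τ k (η, ξ) - τ i (η, ξ))) ≠ 0 :=
      Finset.prod_ne_zero_iff.mpr fun i hi => sub_ne_zero.mpr
        ((hτ.strictMono _ hx).injective.ne (Finset.ne_of_mem_erase hi).symm)
    exact (smul_eq_zero.mp h).resolve_left (Complex.ofReal_ne_zero.mpr hne)
  have hmem := Submodule.mem_map_of_mem (f := complexOp (A (Fin.last n))⁻¹)
    (hτ.mem_iSup_kerSpace_of_adjugate hx hw)
  have heq : v - (-(dxi τ k η ξ : ℂ)) • complexOp (A (Fin.last n))⁻¹ v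
      = complexOp (A (Fin.last n))⁻¹ w := by
    rw [hw_def, complexOp_add, LinearMap.add_apply, complexOp_smul_one, map_add, map_smul,
      complexOp_mul_eq_one (Matrix.nonsing_inv_mul _ hdet), neg_smul, sub_neg_eq_add, add_comm]
  rw [heq]
  simpa only [kerSpaceTilde, Submodule.map_iSup] using hmem

theorem StrictlyHyperbolic.piTildeFreq_eq (hτ : StrictlyHyperbolic A τ)
    {η : EuclideanSpace ℝ (Fin n)} {ξ : ℝ} (hx : (η, ξ) ≠ 0) (k : Fin N) :
    piTildeFreq A τ (τ k (η, ξ)) η ξ = piTilde A τ η ξ k := by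
  have h : IsCharacteristic A (τ k (η, ξ)) η ξ ∧ ∃ j, τ k (η, ξ) = τ j (η, ξ) :=
    ⟨(hτ.isCharacteristic_iff hx).mpr ⟨k, rfl⟩, k, rfl⟩
  have hne : (τ k (η, ξ), η, ξ) ≠ (0 : ℝ × EuclideanSpace ℝ (Fin n) × ℝ) := fun h0 =>
    hx (Prod.mk_eq_zero.mp h0).2
  rw [piTildeFreq, if_neg hne, dif_pos h]
  congr 1
  exact ((hτ.strictMono _ hx).injective h.2.choose_spec).symm

/-- `‖π̃_k E‖` is bounded below by `|∂_ξ τ_k|` on `ker L`, uniformly in the frequency. -/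
theorem StrictlyHyperbolic.exists_abs_dxi_le_norm_piTilde (hA : IsUnit (A (Fin.last n)))
    (hτ : StrictlyHyperbolic A τ) :
    ∃ K : ℝ, 0 < K ∧ ∀ (η : EuclideanSpace ℝ (Fin n)) (ξ : ℝ), (η, ξ) ≠ 0 → ∀ k : Fin N,
      ∀ v ∈ kerSpace A τ η ξ k, |dxi τ k η ξ| * ‖v‖ ≤ K * ‖piTilde A τ η ξ k v‖ := by
  have hdet : IsUnit (A (Fin.last n)).det := (Matrix.isUnit_iff_isUnit_det _).mp hA
  set B := LinearMap.toContinuousLinearMap (complexOp (A (Fin.last n)))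
  refine ⟨‖B‖ + 1, by positivity, fun η ξ hx k v hv => ?_⟩
  have h1 : ‖v‖ ≤ (‖B‖ + 1) * ‖complexOp (A (Fin.last n))⁻¹ v‖ := by
    have h2 : B (complexOp (A (Fin.last n))⁻¹ v) = v :=
      complexOp_mul_eq_one (Matrix.mul_nonsing_inv _ hdet) v
    calc ‖v‖ = ‖B (complexOp (A (Fin.last n))⁻¹ v)‖ := by rw [h2]
      _ ≤ ‖B‖ * ‖complexOp (A (Fin.last n))⁻¹ v‖ := B.le_opNorm _
      _ ≤ _ := by gcongr; linarith
  rw [hτ.piTilde_apply hA hx hv, norm_smul, norm_neg, Complex.norm_real, Real.norm_eq_abs]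
  calc _ ≤ |dxi τ k η ξ| * ((‖B‖ + 1) * ‖complexOp (A (Fin.last n))⁻¹ v‖) := by gcongr
    _ = _ := by ring

/-! ### Uniform constants and conclusion -/

/-- `|∂_ξ τ_k|` is bounded below by the square root of the relative distance to the glancing
set. -/
theorem StrictlyHyperbolic.exists_mul_sqrt_infDist_le (hA : IsUnit (A (Fin.last n)))
    (hτ : StrictlyHyperbolic A τ) (hmult : NondegenerateGlancing τ)
    (hG : (glancingSet A τ).Nonempty) :
    ∃ c : ℝ, 0 < c ∧ ∀ (k : Fin N) (x : SpaceFreq n), x ≠ 0 →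
      c * (Metric.infDist (bdryFreq τ k x) (glancingSet A τ) ^ (1 / 2 : ℝ) /
        ‖bdryFreq τ k x‖ ^ (1 / 2 : ℝ)) ≤ |dxi τ k x.1 x.2| := by
  choose C hC h using hτ.exists_infDist_le hA hmult hG
  -- One positive constant dominating every `C k`.
  set D := ∑ k, C k + 1
  have hD : 0 < D := by
    have := Finset.sum_nonneg fun k (_ : k ∈ Finset.univ) => hC k
    positivity
  refine ⟨(√D)⁻¹, by positivity, fun k x hx => ?_⟩
  have hpos : 0 < ‖bdryFreq τ k x‖ := norm_pos_iff.mpr (hτ.bdryFreq_ne_zero hA hx k)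
  have hCD : C k ≤ D := by
    have := Finset.single_le_sum (fun k _ => hC k) (Finset.mem_univ k)
    linarith
  have hle : Metric.infDist (bdryFreq τ k x) (glancingSet A τ) / ‖bdryFreq τ k x‖
      ≤ D * dxi τ k x.1 x.2 ^ 2 := by
    rw [div_le_iff₀ hpos]
    exact (h k x hx).trans (by gcongr)
  rw [← Real.sqrt_eq_rpow, ← Real.sqrt_eq_rpow, ← Real.sqrt_div Metric.infDist_nonneg,
    inv_mul_le_iff₀ (by positivity), ← Real.sqrt_sq_eq_abs, ← Real.sqrt_mul hD.le]
  exact Real.sqrt_le_sqrt hle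

end HypBVP

theorem mainTheorem9 (n N : ℕ) (hn : 1 ≤ n)
    (A : Fin (n + 1) → Matrix (Fin N) (Fin N) ℝ)
    (hbdry : IsUnit (A (Fin.last n)))
    (τ : Fin N → HypBVP.SpaceFreq n → ℝ)
    (hhyp : HypBVP.StrictlyHyperbolic A τ)
    (hmult : HypBVP.NondegenerateGlancing τ)
    (hG : (HypBVP.glancingSet A τ).Nonempty) :
    ∃ C : ℝ, 0 < C ∧
      ∀ (t : ℝ) (η : EuclideanSpace ℝ (Fin n)) (ξ : ℝ),
        (t, η, ξ) ≠ (0 : ℝ × EuclideanSpace ℝ (Fin n) × ℝ) →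
        HypBVP.IsCharacteristic A t η ξ →
        ∀ k : Fin N, t = τ k (η, ξ) →
          C * (Metric.infDist (WithLp.toLp 2 (t, η)) (HypBVP.glancingSet A τ) ^ (1 / 2 : ℝ) /
              ‖(WithLp.toLp 2 (t, η) : HypBVP.BdryFreq n)‖ ^ (1 / 2 : ℝ)) ≤
            |HypBVP.dxi τ k η ξ| ∧
          ∀ E : EuclideanSpace ℂ (Fin N), E ∈ HypBVP.kerSpace A τ η ξ k → ‖E‖ = 1 →
            C * (Metric.infDist (WithLp.toLp 2 (t, η)) (HypBVP.glancingSet A τ) ^ (1 / 2 : ℝ) /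
                ‖(WithLp.toLp 2 (t, η) : HypBVP.BdryFreq n)‖ ^ (1 / 2 : ℝ)) ≤
              ‖HypBVP.piTildeFreq A τ t η ξ E‖ := by
  obtain ⟨c, hc, hbound⟩ := hhyp.exists_mul_sqrt_infDist_le hbdry hmult hG
  obtain ⟨K, hK, hproj⟩ := hhyp.exists_abs_dxi_le_norm_piTilde hbdry
  have hK1 : 0 < max K 1 := hK.trans_le (le_max_left _ _)
  -- Dividing by at least 1 only weakens the first bound; dividing by at least `K` absorbs the loss
  -- in the second.
  refine ⟨c / max K 1, by positivity, ?_⟩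
  rintro t η ξ hα hchar k rfl
  -- At `(η, ξ) = 0` the symbol is `t I`, which is singular only for `t = 0`, excluded by `α ≠ 0`.
  have hx : (η, ξ) ≠ (0 : EuclideanSpace ℝ (Fin n) × ℝ) := by
    intro hx
    obtain ⟨rfl, rfl⟩ := Prod.mk_eq_zero.mp hx
    have ht : τ k 0 ≠ 0 := fun ht => hα (Prod.ext ht rfl)
    simp [HypBVP.IsCharacteristic, HypBVP.symbol, HypBVP.spatialSymbol] at hchar
    exact ht hchar.1
  have h := hbound k (η, ξ) hx
  simp only [HypBVP.bdryFreq] at h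
  rw [div_mul_eq_mul_div]
  refine ⟨?_, fun E hE hE1 => ?_⟩
  · refine (div_le_self (mul_nonneg hc.le (div_nonneg ?_ ?_)) (le_max_right K 1)).trans h
    · exact Real.rpow_nonneg Metric.infDist_nonneg _
    · exact Real.rpow_nonneg (norm_nonneg _) _
  · rw [hhyp.piTildeFreq_eq hx, div_le_iff₀' hK1]
    have h2 := hproj η ξ hx k E hE
    rw [hE1, mul_one] at h2
    exact (h.trans h2).trans (by gcongr; exact le_max_left _ _)
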